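/- Let $\mathbb T$ be the unit circle, identified with $\mathbb R/\mathbb Z$ via $\theta\mapsto e^{2\pi i\theta}$ and equipped with the distance of $\mathbb R/\mathbb Z$; let $m$ be Lebesgue measure on $\mathbb T$ with $m(\mathbb T)=1$. For a finite positive measure $\rho$ on $\mathbb T$ and $n\ge 0$ put $$e_n(\rho)=\min_{q_0,\dots,q_{n-1}\in\mathbb C}\Bigl(\int_{\mathbb T}\bigl|q_0+q_1t+\dots+q_{n-1}t^{n-1}+t^n\bigr|^2\,d\rho(t)\Bigr)^{1/2}.$$ For $K\subset\mathbb T$ let $d_K(t)=\operatorname{dist}(t,K)$. Let $\gamma\in[0,1)$ and $a,b>0$. Then there are constants $c,C>0$, depending only on $\gamma,a,b$, with the following property. Let $K\subset\mathbb T$ be a compact set that is $\gamma$-regular with constants $a,b$, i.e. $$a\,s^{1-\gamma}\le m\{t\in\mathbb T: d_K(t)<s\}\le b\,s^{1-\gamma}\qquad\text{for all } 0<s\le\tfrac12,$$ and let $d\rho=\exp\bigl(-d_K^{\gamma-1}\bigr)\,dm$ (the density being $0$ on $K$). Then for all integers $n\ge2$ $$c\,\log n\le|\log e_n(\rho)|\le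 C\,\log n .$$ -/

import Mathlib

/-- The circle `𝕋`, identified with `ℝ/ℤ`, with its distance `|x - y|` modulo `1`; the point `t`
corresponds to the complex number `exp (2 π i t)`, which is `AddCircle.toCircle t`, and
`AddCircle.haarAddCircle` is Lebesgue measure `m` with `m (𝕋) = 1`. -/
abbrev SzegoCircle : Type := UnitAddCircle

/-- `e_n(ρ)`: the infimum over `q_0, …, q_{n-1} ∈ ℂ` of the `L²(ρ)`-norm of
`q_0 + q_1 t + ⋯ + q_{n-1} t^{n-1} + t^n` on the unit circle. -/
noncomputable def szegoMin (ρ : MeasureTheory.Measure SzegoCircle) (n : ℕ) : ℝ :=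
  ⨅ q : Fin n → ℂ,
    Real.sqrt (∫ t : SzegoCircle,
      ‖(∑ j : Fin n, q j * (AddCircle.toCircle t : ℂ) ^ (j : ℕ))
        + (AddCircle.toCircle t : ℂ) ^ n‖ ^ 2 ∂ρ)

/-- `ψ_K(s)`: the normalized length of the open `s`-neighbourhood `{t | dist (t, K) < s}`. -/
noncomputable def nbhdLength (K : Set SzegoCircle) (s : ℝ) : ℝ :=
  AddCircle.haarAddCircle.real (Metric.thickening s K)

/-- `K` is `γ`-regular with constants `a`, `b`: `a s^{1-γ} ≤ ψ_K(s) ≤ b s^{1-γ}` for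
`0 < s ≤ 1/2` (distances on `ℝ/ℤ` do not exceed `1/2`). -/
def IsGammaRegularWith (γ a b : ℝ) (K : Set SzegoCircle) : Prop :=
  ∀ s : ℝ, 0 < s → s ≤ 1 / 2 →
    a * s ^ (1 - γ) ≤ nbhdLength K s ∧ nbhdLength K s ≤ b * s ^ (1 - γ)

/-- The measure `exp (-d_K^{γ-1}) dm`, where `d_K` is the distance to `K`. For `γ < 1` and closed
`K` the exponent is `-∞` exactly on `K`, so the density is `0` there. -/
noncomputable def deepZeroMeasure (γ : ℝ) (K : Set SzegoCircle) :
    MeasureTheory.Measure SzegoCircle :=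
  AddCircle.haarAddCircle.withDensity
    (Kᶜ.indicator fun t => ENNReal.ofReal (Real.exp (-(Metric.infDist t K ^ (γ - 1)))))

/-! Put `κ = 1 - γ` and `v_s = max (d_K, s) ^ (-κ)`. By the layer cake formula, regularity makes `∫
v_s` comparable to `log (1/s)`, up to an additive constant. Both bounds say that `e_n²` behaves like
`exp (-∫ v_s)` with `s` a negative power of `n`.

Lower bound: a monic `P` has `∫ log ‖P‖ ≥ 0`, so Jensen's inequality gives `∫ ‖P‖² exp (-v_s) ≥ exp
(-∫ v_s)`. The true density differs from `exp (-v_s)` only within distance `s` of `K`. If `s ^ κ` is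
a small multiple of `1/n`, Nikolskii's inequality shows that this neighbourhood carries at most half
of `∫ ‖P‖²`, so passing to the true density costs only a factor 2 (`exp_neg_le_two_mul_integral`).

Upper bound: an ideal competitor has modulus `exp ((v_s - ∫ v_s) / 2)`, the exponential of an
analytic function. A Fejér mean makes the exponent a polynomial vanishing at 0, and truncating the
exponential series makes the whole a polynomial with constant term 1; its reversal is monic with the
same modulus on the circle. With `s = 1/m` the degree is at most `4 m ^ 9`
(`szegoMin_le_exp_neg_integral_truncWeight`), so `m` of order `n ^ (1/10)` is admissible and still
gives `log (1/s)` of order `log n`. -/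

open MeasureTheory Polynomial

/-! ### Polynomials on the circle -/

/-- The point `exp (2 π i t)` of the unit circle. -/
noncomputable abbrev circlePoint (t : SzegoCircle) : ℂ := (AddCircle.toCircle t : ℂ)

theorem norm_circlePoint (t : SzegoCircle) : ‖circlePoint t‖ = 1 := Circle.norm_coe _

theorem continuous_circlePoint : Continuous circlePoint :=
  continuous_subtype_val.comp AddCircle.continuous_toCircle

theorem circlePoint_coe (x : ℝ) :
    circlePoint (x : SzegoCircle) = circleMap 0 1 (2 * Real.pi * x) := by
  simp [circlePoint, AddCircle.toCircle, circleMap]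

theorem haarAddCircle_eq_volume :
    (AddCircle.haarAddCircle : Measure SzegoCircle) = volume := by
  rw [AddCircle.volume_eq_smul_haarAddCircle]; simp

theorem integral_comp_circlePoint (f : ℂ → ℝ) :
    ∫ t : SzegoCircle, f (circlePoint t) ∂AddCircle.haarAddCircle = Real.circleAverage f 0 1 := by
  rw [haarAddCircle_eq_volume, ← UnitAddCircle.intervalIntegral_preimage 0, Real.circleAverage_def]
  simp_rw [circlePoint_coe]
  rw [intervalIntegral.integral_comp_mul_left (fun x => f (circleMap 0 1 x)) (by positivity)]
  simp

theorem integrable_log_norm_eval (P : ℂ[X]) :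
    Integrable (fun t : SzegoCircle => Real.log ‖P.eval (circlePoint t)‖)
      AddCircle.haarAddCircle := by
  rw [haarAddCircle_eq_volume]
  have hm : Measurable (fun t : SzegoCircle => Real.log ‖P.eval (circlePoint t)‖) :=
    Real.measurable_log.comp (P.continuous.comp continuous_circlePoint).norm.measurable
  rw [← (UnitAddCircle.measurePreserving_mk 0).integrable_comp hm.aestronglyMeasurable]
  have h := (intervalIntegrable_mahlerMeasure (p := P)).comp_mul_left (c := 2 * Real.pi)
  rw [zero_div, div_self (by positivity), intervalIntegrable_iff_integrableOn_Ioc_of_le zero_le_one]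
    at h
  simpa [Function.comp_def, circlePoint_coe, IntegrableOn] using h

/-- Jensen's formula: the integral is the logarithmic Mahler measure, which is nonnegative when the
leading coefficient is 1. -/
theorem integral_log_norm_eval_nonneg {P : ℂ[X]} (hP : P.Monic) :
    0 ≤ ∫ t : SzegoCircle, Real.log ‖P.eval (circlePoint t)‖ ∂AddCircle.haarAddCircle := by
  rw [integral_comp_circlePoint (fun z => Real.log ‖P.eval z‖), ← logMahlerMeasure_def,
    logMahlerMeasure_eq_log_MahlerMeasure]
  exact Real.log_nonneg (one_le_mahlerMeasure_of_one_le_norm_leadingCoeff (by simp [hP]))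

theorem ae_eval_circlePoint_ne_zero {P : ℂ[X]} (hP : P ≠ 0) :
    ∀ᵐ t : SzegoCircle ∂AddCircle.haarAddCircle, P.eval (circlePoint t) ≠ 0 := by
  have hfin : {t : SzegoCircle | P.eval (circlePoint t) = 0}.Finite := by
    have : {t : SzegoCircle | P.eval (circlePoint t) = 0} = circlePoint ⁻¹' {z | P.IsRoot z} := rfl
    rw [this]
    exact (finite_setOfPred_isRoot hP).preimage fun x _ y _ h =>
      AddCircle.injective_toCircle one_ne_zero (Circle.coe_injective h)
  rw [haarAddCircle_eq_volume]
  have hsingle : NullSingletonClass (volume : Measure SzegoCircle) := ⟨fun x => by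
    rw [← Metric.closedBall_zero, AddCircle.volume_closedBall]; simp⟩
  exact compl_mem_ae_iff.2 (Set.Countable.measure_zero hfin.countable _)

/-- Nikolskii's inequality between the uniform norm and the `L²` norm. -/
theorem norm_eval_sq_le_integral (P : ℂ[X]) (t : SzegoCircle) :
    ‖P.eval (circlePoint t)‖ ^ 2 ≤ (P.natDegree + 1) *
      ∫ τ : SzegoCircle, ‖P.eval (circlePoint τ)‖ ^ 2 ∂AddCircle.haarAddCircle := by
  rw [integral_comp_circlePoint (fun z => ‖P.eval z‖ ^ 2), ← P.sum_sq_norm_coeff_eq_circleAverage]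
  have h1 : ‖P.eval (circlePoint t)‖ ≤ ∑ i ∈ P.support, ‖P.coeff i‖ := by
    rw [eval_eq_sum, Polynomial.sum]
    refine (norm_sum_le _ _).trans (Finset.sum_le_sum fun i _ => ?_)
    rw [norm_mul, norm_pow, norm_circlePoint, one_pow, mul_one]
  calc ‖P.eval (circlePoint t)‖ ^ 2 ≤ (∑ i ∈ P.support, ‖P.coeff i‖) ^ 2 := by gcongr
    _ ≤ P.support.card * ∑ i ∈ P.support, ‖P.coeff i‖ ^ 2 := sq_sum_le_card_mul_sum_sq
    _ ≤ _ := by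
      gcongr
      exact_mod_cast P.card_supp_le_succ_natDegree

theorem integral_circlePoint_pow_succ (k : ℕ) :
    ∫ t : SzegoCircle, circlePoint t ^ (k + 1) ∂AddCircle.haarAddCircle = 0 := by
  have h : ∀ t : SzegoCircle, circlePoint t ^ (k + 1) = fourier ((k + 1 : ℕ) : ℤ) t := fun t => by
    rw [fourier_apply, natCast_zsmul, AddCircle.toCircle_nsmul]; simp
  simp_rw [h]
  exact integral_eq_zero_of_add_right_eq_neg (μ := AddCircle.haarAddCircle)
    (fourier_add_half_inv_index (T := 1) (by positivity) one_pos)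

/-- The chord has length `2 |sin (π x)|`, and Jordan's inequality applies for `|x| ≤ 1/2`. -/
theorem norm_le_norm_circlePoint_sub_one (t : SzegoCircle) : 4 * ‖t‖ ≤ ‖circlePoint t - 1‖ := by
  obtain ⟨x, hx, rfl⟩ : ∃ x : ℝ, |x| ≤ 1 / 2 ∧ (x : SzegoCircle) = t := by
    induction t using QuotientAddGroup.induction_on with
    | H y =>
      refine ⟨y - round y, abs_sub_round y, ?_⟩
      rw [AddCircle.coe_sub, sub_eq_self]
      exact AddCircle.coe_eq_zero_iff 1 |>.2 ⟨round y, by simp⟩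
  have h1 : ‖(x : SzegoCircle)‖ = |x| :=
    (AddCircle.norm_coe_eq_abs_iff 1 one_ne_zero).2 (by simpa using hx)
  have h2 : circlePoint (x : SzegoCircle) = Complex.exp (Complex.I * ((2 * Real.pi * x : ℝ) : ℂ)) := by
    rw [circlePoint_coe, circleMap_zero]; push_cast; ring_nf
  have h3 := Real.mul_abs_le_abs_sin (x := Real.pi * x) (by
    rw [abs_mul, abs_of_pos Real.pi_pos]; nlinarith [Real.pi_pos])
  rw [h1, h2, Complex.norm_exp_I_mul_ofReal_sub_one, norm_mul, Real.norm_eq_abs, Real.norm_eq_abs,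
    show 2 * Real.pi * x / 2 = Real.pi * x by ring, abs_two]
  rw [abs_mul, abs_of_pos Real.pi_pos] at h3
  have : 2 / Real.pi * (Real.pi * |x|) = 2 * |x| := by field_simp
  linarith

/-! ### The truncated weight and its integral -/

/-- The function `max (d_K, s) ^ (-κ)`. -/
noncomputable def truncWeight (κ s : ℝ) (K : Set SzegoCircle) (t : SzegoCircle) : ℝ :=
  max (Metric.infDist t K) s ^ (-κ)

section
variable {κ s : ℝ} {K : Set SzegoCircle}

theorem truncWeight_nonneg (hs : 0 < s) (t : SzegoCircle) : 0 ≤ truncWeight κ s K t :=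
  Real.rpow_nonneg (hs.le.trans (le_max_right _ _)) _

theorem truncWeight_le (hκ : 0 ≤ κ) (hs : 0 < s) (t : SzegoCircle) :
    truncWeight κ s K t ≤ s ^ (-κ) :=
  Real.rpow_le_rpow_of_nonpos hs (le_max_right _ _) (neg_nonpos.2 hκ)

theorem continuous_truncWeight (hs : 0 < s) : Continuous (truncWeight κ s K) :=
  ((Metric.continuous_infDist_pt K).max continuous_const).rpow_const fun _ =>
    Or.inl (hs.trans_le (le_max_right _ _)).ne'

theorem integrable_of_continuous {E : Type*} [NormedAddCommGroup E] {f : SzegoCircle → E}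
    (hf : Continuous f) : Integrable f AddCircle.haarAddCircle :=
  hf.integrable_of_hasCompactSupport (HasCompactSupport.of_compactSpace f)

theorem IsGammaRegularWith.nonempty {γ a b : ℝ} (ha : 0 < a) (h : IsGammaRegularWith γ a b K) :
    K.Nonempty := by
  by_contra hK
  rw [Set.not_nonempty_iff_eq_empty] at hK
  have := (h (1 / 2) (by norm_num) le_rfl).1
  simp only [nbhdLength, hK, Metric.thickening_empty, measureReal_empty] at this
  have : 0 < a * (1 / 2 : ℝ) ^ (1 - γ) := by positivity
  linarith

theorem lt_rpow_neg_iff {x y κ : ℝ} (hx : 0 < x) (hy : 0 < y) (hκ : 0 < κ) :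
    y < x ^ (-κ) ↔ x < y ^ (-κ⁻¹) := by
  rw [← Real.rpow_lt_rpow_iff_of_neg (x := y ^ (-κ⁻¹)) (y := x) (by positivity) hx (neg_lt_zero.2 hκ),
    ← Real.rpow_mul hy.le]
  simp [hκ.ne']

theorem superlevel_truncWeight (hκ : 0 < κ) (hs : 0 < s) (hK : K.Nonempty) {y : ℝ} (hy : 0 < y)
    (hys : y < s ^ (-κ)) :
    {t | y < truncWeight κ s K t} = Metric.thickening (y ^ (-κ⁻¹)) K := by
  ext t
  rw [Set.mem_ofPred_eq, truncWeight, lt_rpow_neg_iff (hs.trans_le (le_max_right _ _)) hy hκ,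
    max_lt_iff, Metric.mem_thickening_iff_infDist_lt hK]
  exact and_iff_left ((lt_rpow_neg_iff hs hy hκ).1 hys)

/-- Layer cake: the set where the weight exceeds `y` is the neighbourhood of `K` of radius `y ^
(-1/κ)`, whose length regularity places between `a / y` and `b / y`. This holds from `y = 2 ^ κ`,
where the radius is `1/2`, up to the maximal value `s ^ (-κ)`; below `2 ^ κ` the length is merely
between 0 and 1. -/
theorem integral_truncWeight_bounds {γ a b : ℝ} (hγ1 : γ < 1)
    (hK : K.Nonempty) (h : IsGammaRegularWith γ a b K) (hs : 0 < s) (hs2 : s ≤ 1 / 2) :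
    a * Real.log (s ^ (-(1 - γ)) / 2 ^ (1 - γ)) ≤
        ∫ t, truncWeight (1 - γ) s K t ∂AddCircle.haarAddCircle ∧
      ∫ t, truncWeight (1 - γ) s K t ∂AddCircle.haarAddCircle ≤
        2 ^ (1 - γ) + b * Real.log (s ^ (-(1 - γ)) / 2 ^ (1 - γ)) := by
  set κ := 1 - γ with hκdef
  have hκ : 0 < κ := by linarith
  set Y := s ^ (-κ) with hY
  set c : ℝ := 2 ^ κ with hc
  have hc0 : 0 < c := by positivity
  have hcY : c ≤ Y := by
    rw [hc, hY, show (2 : ℝ) = (1 / 2)⁻¹ by norm_num, Real.inv_rpow (by norm_num),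
      ← Real.rpow_neg (by norm_num)]
    exact Real.rpow_le_rpow_of_nonpos hs hs2 (by linarith)
  set g : ℝ → ℝ := fun y => AddCircle.haarAddCircle.real {t | y < truncWeight κ s K t} with hg
  have hanti : Antitone g := fun x y hxy =>
    measureReal_mono fun t (ht : y < _) => hxy.trans_lt ht
  have hint : ∀ x y, IntervalIntegrable g volume x y := fun x y => hanti.intervalIntegrable
  have hX : ∫ t, truncWeight κ s K t ∂AddCircle.haarAddCircle =
      (∫ y in 0..c, g y) + ∫ y in c..Y, g y := by
    rw [intervalIntegral.integral_add_adjacent_intervals (hint _ _) (hint _ _),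
      (integrable_of_continuous (continuous_truncWeight hs)).integral_eq_integral_meas_lt
        (Filter.Eventually.of_forall (truncWeight_nonneg hs)),
      intervalIntegral.integral_of_le (hc0.le.trans hcY)]
    refine setIntegral_eq_of_subset_of_forall_sdiff_eq_zero measurableSet_Ioi
      Set.Ioc_subset_Ioi_self fun y hy => ?_
    have hyY : Y < y := by
      by_contra hle
      exact hy.2 ⟨hy.1, not_lt.1 hle⟩
    have : {t | y < truncWeight κ s K t} = ∅ :=
      Set.eq_empty_of_forall_notMem fun t (ht : y < _) =>
        absurd (truncWeight_le hκ.le hs t) (not_le.2 (hyY.trans ht))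
    rw [this, measureReal_empty]
  have h01 : 0 ≤ ∫ y in 0..c, g y :=
    intervalIntegral.integral_nonneg hc0.le fun y _ => measureReal_nonneg
  have h02 : ∫ y in 0..c, g y ≤ c := by
    have := intervalIntegral.integral_mono_on hc0.le (hint 0 c)
      (intervalIntegrable_const (c := (1 : ℝ))) fun y _ => measureReal_le_one
    simpa using this
  have hmid : ∀ y ∈ Set.Ioo c Y, a * y⁻¹ ≤ g y ∧ g y ≤ b * y⁻¹ := by
    rintro y ⟨hy1, hy2⟩
    have hy0 : 0 < y := hc0.trans hy1
    have hle : y ^ (-κ⁻¹) ≤ 1 / 2 := by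
      have := (lt_rpow_neg_iff (x := 1 / 2) (by norm_num) hy0 hκ).not
      refine not_lt.1 (this.1 (not_lt.2 ?_))
      rw [Real.rpow_neg (by norm_num), ← Real.inv_rpow (by norm_num)]
      norm_num
      exact hy1.le
    have := h _ (Real.rpow_pos_of_pos hy0 _) hle
    rw [← hκdef, ← Real.rpow_mul hy0.le, neg_mul, inv_mul_cancel₀ hκ.ne', Real.rpow_neg_one] at this
    rw [hg]
    simp only [superlevel_truncWeight hκ hs hK hy0 hy2]
    exact this
  have hinv : ∀ r : ℝ, ∫ y in c..Y, r * y⁻¹ = r * Real.log (Y / c) := fun r => by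
    rw [intervalIntegral.integral_const_mul, integral_inv_of_pos hc0 (hc0.trans_le hcY)]
  have hii : ∀ r : ℝ, IntervalIntegrable (fun y => r * y⁻¹) volume c Y := fun r =>
    (intervalIntegral.intervalIntegrable_inv (fun x hx => by
      rw [Set.uIcc_of_le hcY] at hx; exact (hc0.trans_le hx.1).ne') continuousOn_id).const_mul r
  have l1 := intervalIntegral.integral_mono_on_of_le_Ioo hcY (hii a) (hint c Y) fun y hy => (hmid y hy).1
  have l2 := intervalIntegral.integral_mono_on_of_le_Ioo hcY (hint c Y) (hii b) fun y hy => (hmid y hy).2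
  rw [hinv] at l1 l2
  rw [hX]
  constructor <;> linarith

end

/-! ### From the truncated weight to the true density -/

/-- The density `exp (-d_K^{γ-1})` of `deepZeroMeasure γ K` as a real function. -/
noncomputable def deepZeroDensity (γ : ℝ) (K : Set SzegoCircle) : SzegoCircle → ℝ :=
  Kᶜ.indicator fun t => Real.exp (-(Metric.infDist t K ^ (γ - 1)))

section
variable {γ s : ℝ} {K : Set SzegoCircle}

theorem deepZeroDensity_nonneg (t : SzegoCircle) : 0 ≤ deepZeroDensity γ K t :=
  Set.indicator_nonneg (fun _ _ => (Real.exp_pos _).le) t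

theorem measurable_deepZeroDensity (hK : IsCompact K) : Measurable (deepZeroDensity γ K) :=
  ((Real.measurable_exp.comp
    ((Metric.continuous_infDist_pt K).measurable.pow_const _).neg)).indicator hK.measurableSet.compl

theorem deepZeroDensity_le_one (t : SzegoCircle) : deepZeroDensity γ K t ≤ 1 :=
  Set.indicator_le_self' (fun _ _ => zero_le_one) t |>.trans' <| by
    refine Set.indicator_le_indicator ?_ |>.trans_eq rfl
    exact Real.exp_le_one_iff.2 (neg_nonpos.2 (Real.rpow_nonneg Metric.infDist_nonneg _))

theorem integral_deepZeroMeasure (hK : IsCompact K) (f : SzegoCircle → ℝ) :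
    ∫ t, f t ∂deepZeroMeasure γ K = ∫ t, deepZeroDensity γ K t * f t ∂AddCircle.haarAddCircle := by
  have h : (Kᶜ.indicator fun t => ENNReal.ofReal (Real.exp (-(Metric.infDist t K ^ (γ - 1))))) =
      fun t => ENNReal.ofReal (deepZeroDensity γ K t) := by
    ext t
    by_cases ht : t ∈ K <;> simp [deepZeroDensity, ht]
  rw [deepZeroMeasure, h, integral_withDensity_eq_integral_toReal_smul
    (measurable_deepZeroDensity hK).ennreal_ofReal (by simp)]
  simp_rw [ENNReal.toReal_ofReal (deepZeroDensity_nonneg _), smul_eq_mul]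

theorem integrable_deepZeroDensity_mul (hK : IsCompact K) {f : SzegoCircle → ℝ}
    (hf : Continuous f) :
    Integrable (fun t => deepZeroDensity γ K t * f t) AddCircle.haarAddCircle :=
  (integrable_of_continuous hf).bdd_mul (c := 1)
    (measurable_deepZeroDensity hK).aestronglyMeasurable
    (Filter.Eventually.of_forall fun t => by
      rw [Real.norm_of_nonneg (deepZeroDensity_nonneg t)]; exact deepZeroDensity_le_one t)

theorem deepZeroDensity_eq_of_le (hs : 0 < s) {t : SzegoCircle} (ht : s ≤ Metric.infDist t K) :
    deepZeroDensity γ K t = Real.exp (-truncWeight (1 - γ) s K t) := by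
  have htK : t ∈ Kᶜ := fun hmem => by
    rw [Metric.infDist_zero_of_mem hmem] at ht; linarith
  rw [deepZeroDensity, Set.indicator_of_mem htK, truncWeight, max_eq_left ht, neg_sub]

theorem deepZeroDensity_le_exp_neg_truncWeight (hK : IsCompact K) (hne : K.Nonempty) (hγ1 : γ < 1)
    (t : SzegoCircle) : deepZeroDensity γ K t ≤ Real.exp (-truncWeight (1 - γ) s K t) := by
  by_cases ht : t ∈ K
  · rw [deepZeroDensity, Set.indicator_of_notMem (by simpa using ht)]
    exact (Real.exp_pos _).le
  · have hpos : 0 < Metric.infDist t K := (hK.isClosed.notMem_iff_infDist_pos hne).1 ht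
    rw [deepZeroDensity, Set.indicator_of_mem (by simpa using ht), truncWeight, neg_sub]
    exact Real.exp_le_exp.2 (neg_le_neg
      (Real.rpow_le_rpow_of_nonpos hpos (le_max_left _ _) (by linarith)))

/-- Jensen's inequality for `exp`, applied to `2 log ‖P‖ - v_s` on a probability space. -/
theorem exp_neg_integral_truncWeight_le {κ : ℝ} (hs : 0 < s) {P : ℂ[X]} (hP : P.Monic) :
    Real.exp (-∫ t, truncWeight κ s K t ∂AddCircle.haarAddCircle) ≤
      ∫ t, ‖P.eval (circlePoint t)‖ ^ 2 * Real.exp (-truncWeight κ s K t)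
        ∂AddCircle.haarAddCircle := by
  set f : SzegoCircle → ℝ := fun t => 2 * Real.log ‖P.eval (circlePoint t)‖ - truncWeight κ s K t
  have hi1 := (integrable_log_norm_eval P).const_mul 2
  have hi2 := integrable_of_continuous (continuous_truncWeight (κ := κ) (K := K) hs)
  have hfi : Integrable f AddCircle.haarAddCircle := hi1.sub hi2
  have hae : (fun t => Real.exp (f t)) =ᵐ[AddCircle.haarAddCircle]
      fun t => ‖P.eval (circlePoint t)‖ ^ 2 * Real.exp (-truncWeight κ s K t) := by
    filter_upwards [ae_eval_circlePoint_ne_zero hP.ne_zero] with t ht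
    have := norm_pos_iff.2 ht
    rw [show f t = Real.log ‖P.eval (circlePoint t)‖ + Real.log ‖P.eval (circlePoint t)‖
        + -truncWeight κ s K t by simp only [f]; ring, Real.exp_add, Real.exp_add,
      Real.exp_log this, sq]
  have hcont : Continuous fun t => ‖P.eval (circlePoint t)‖ ^ 2 * Real.exp (-truncWeight κ s K t) :=
    ((P.continuous.comp continuous_circlePoint).norm.pow 2).mul
      (Real.continuous_exp.comp (continuous_truncWeight hs).neg)
  have hJ := convexOn_exp.map_integral_le (μ := AddCircle.haarAddCircle)
    Real.continuous_exp.continuousOn isClosed_univ (by simp) hfi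
    ((integrable_of_continuous hcont).congr hae.symm)
  rw [← integral_congr_ae hae]
  refine le_trans (Real.exp_le_exp.2 ?_) hJ
  rw [integral_sub hi1 hi2, integral_const_mul]
  linarith [integral_log_norm_eval_nonneg hP]

/-- On the neighbourhood `E` the factor `exp (-v_s)` is constant and equal to its minimum `μ`. As
`E` carries no more of `∫ ‖P‖²` than its complement, the same is true with the weight, and off `E`
the weight is the true density. -/
theorem exp_neg_le_two_mul_integral (hK : IsCompact K) (hne : K.Nonempty) (hγ1 : γ < 1)
    (hs : 0 < s) {P : ℂ[X]} (hP : P.Monic) (hm : nbhdLength K s * (P.natDegree + 1) ≤ 1 / 2) :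
    Real.exp (-∫ t, truncWeight (1 - γ) s K t ∂AddCircle.haarAddCircle) ≤
      2 * ∫ t, deepZeroDensity γ K t * ‖P.eval (circlePoint t)‖ ^ 2 ∂AddCircle.haarAddCircle := by
  refine (exp_neg_integral_truncWeight_le hs hP).trans ?_
  set F : SzegoCircle → ℝ := fun t => ‖P.eval (circlePoint t)‖ ^ 2
  set E := Metric.thickening s K
  set v := truncWeight (1 - γ) s K
  have hFc : Continuous F := (P.continuous.comp continuous_circlePoint).norm.pow 2
  have hF0 : ∀ t, 0 ≤ F t := fun t => sq_nonneg _
  have hvc : Continuous v := continuous_truncWeight hs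
  have hwc : Continuous fun t => F t * Real.exp (-v t) := hFc.mul (Real.continuous_exp.comp hvc.neg)
  have hFi := integrable_of_continuous hFc
  have hwi := integrable_of_continuous hwc
  have hE : MeasurableSet E := Metric.isOpen_thickening.measurableSet
  set I := ∫ t, F t ∂AddCircle.haarAddCircle
  have hI0 : 0 ≤ I := integral_nonneg hF0
  set μ := Real.exp (-(s ^ (-(1 - γ))))
  have hEF : ∫ t in E, F t ∂AddCircle.haarAddCircle ≤ ∫ t in Eᶜ, F t ∂AddCircle.haarAddCircle := by
    have h1 : ∫ t in E, F t ∂AddCircle.haarAddCircle ≤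
        ∫ _ in E, (P.natDegree + 1) * I ∂AddCircle.haarAddCircle :=
      setIntegral_mono hFi.integrableOn (integrable_const _).integrableOn
        fun t => norm_eval_sq_le_integral P t
    rw [setIntegral_const, smul_eq_mul] at h1
    have h2 := integral_add_compl hE hFi
    change nbhdLength K s * (P.natDegree + 1) ≤ _ at hm
    change _ ≤ nbhdLength K s * _ at h1
    nlinarith
  have h1 : ∫ t in E, F t * Real.exp (-v t) ∂AddCircle.haarAddCircle =
      μ * ∫ t in E, F t ∂AddCircle.haarAddCircle := by
    rw [← integral_const_mul]
    refine setIntegral_congr_fun hE fun t ht => ?_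
    have : Metric.infDist t K < s := (Metric.mem_thickening_iff_infDist_lt hne).1 ht
    simp only [v, truncWeight, max_eq_right this.le, μ, mul_comm]
  have h2 : μ * ∫ t in Eᶜ, F t ∂AddCircle.haarAddCircle ≤
      ∫ t in Eᶜ, F t * Real.exp (-v t) ∂AddCircle.haarAddCircle := by
    rw [← integral_const_mul]
    refine setIntegral_mono (hFi.const_mul _).integrableOn hwi.integrableOn fun t => ?_
    change μ * F t ≤ F t * _
    rw [mul_comm]
    refine mul_le_mul_of_nonneg_left (Real.exp_le_exp.2 (neg_le_neg ?_)) (hF0 t)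
    exact truncWeight_le (by linarith) hs t
  have h3 : ∫ t in Eᶜ, F t * Real.exp (-v t) ∂AddCircle.haarAddCircle ≤
      ∫ t, deepZeroDensity γ K t * F t ∂AddCircle.haarAddCircle := by
    refine le_trans (le_of_eq ?_) (setIntegral_le_integral (s := Eᶜ)
      (integrable_deepZeroDensity_mul hK hFc)
      (Filter.Eventually.of_forall fun t => mul_nonneg (deepZeroDensity_nonneg t) (hF0 t)))
    refine setIntegral_congr_fun hE.compl fun t ht => ?_
    have : s ≤ Metric.infDist t K :=
      not_lt.1 fun h => ht ((Metric.mem_thickening_iff_infDist_lt hne).2 h)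
    simp only [deepZeroDensity_eq_of_le hs this, v, mul_comm]
  rw [← integral_add_compl hE hwi, h1]
  have := mul_le_mul_of_nonneg_left hEF (Real.exp_pos (-(s ^ (-(1 - γ))))).le
  linarith

end

/-! ### The lower bound -/

/-- The monic polynomial with lower coefficients `q`. -/
noncomputable def monicOfCoeffs {n : ℕ} (q : Fin n → ℂ) : ℂ[X] :=
  X ^ n + ∑ j : Fin n, C (q j) * X ^ (j : ℕ)

theorem monic_monicOfCoeffs {n : ℕ} (q : Fin n → ℂ) : (monicOfCoeffs q).Monic :=
  monic_X_pow_add (Polynomial.degree_sum_fin_lt q)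

theorem natDegree_monicOfCoeffs {n : ℕ} (q : Fin n → ℂ) : (monicOfCoeffs q).natDegree = n :=
  natDegree_eq_of_degree_eq_some <| (degree_add_eq_left_of_degree_lt
    (by rw [degree_X_pow]; exact Polynomial.degree_sum_fin_lt q)).trans (degree_X_pow n)

theorem eval_monicOfCoeffs {n : ℕ} (q : Fin n → ℂ) (z : ℂ) :
    (monicOfCoeffs q).eval z = (∑ j : Fin n, q j * z ^ (j : ℕ)) + z ^ n := by
  simp [monicOfCoeffs, eval_finsetSum, add_comm]

theorem szegoMin_deepZeroMeasure {γ : ℝ} {K : Set SzegoCircle} (hK : IsCompact K) (n : ℕ) :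
    szegoMin (deepZeroMeasure γ K) n = ⨅ q : Fin n → ℂ, Real.sqrt
      (∫ t, deepZeroDensity γ K t * ‖(monicOfCoeffs q).eval (circlePoint t)‖ ^ 2
        ∂AddCircle.haarAddCircle) := by
  simp_rw [szegoMin, integral_deepZeroMeasure hK, eval_monicOfCoeffs]

theorem bddBelow_range_sqrt {ι : Type*} (f : ι → ℝ) :
    BddBelow (Set.range fun i => Real.sqrt (f i)) :=
  ⟨0, by rintro _ ⟨i, rfl⟩; exact Real.sqrt_nonneg _⟩

/-- The lower bound for `e_n`. -/
theorem szegoMin_lower_bound {γ a b : ℝ} (hγ1 : γ < 1) (ha : 0 < a) (hb : 0 < b) :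
    ∃ A B : ℝ, 0 ≤ A ∧ 0 ≤ B ∧ ∀ K : Set SzegoCircle, IsCompact K → IsGammaRegularWith γ a b K →
      ∀ n : ℕ, 2 ≤ n →
        Real.exp (-(A * Real.log n + B)) ≤ szegoMin (deepZeroMeasure γ K) n := by
  set κ := 1 - γ with hκdef
  have hκ : 0 < κ := by linarith
  -- With `s ^ κ = η / n`, the first entry makes `b (η / n) (n + 1) ≤ 2 b η ≤ 1/2`; the second gives
  -- `s ≤ 1/2`.
  set η : ℝ := min (1 / (4 * b)) ((1 / 2) ^ κ) with hη
  have hη0 : 0 < η := by positivity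
  refine ⟨b / 2, (2 ^ κ + b * |Real.log (η⁻¹ / 2 ^ κ)| + Real.log 2) / 2, by positivity,
    by positivity, fun K hK hreg n hn => ?_⟩
  have hne := hreg.nonempty ha
  have hn0 : (0 : ℝ) < n := by positivity
  have hn1 : (1 : ℝ) ≤ n := by exact_mod_cast (by omega : 1 ≤ n)
  set s : ℝ := (η / n) ^ κ⁻¹ with hs
  have hs0 : 0 < s := by positivity
  have hsκ : s ^ κ = η / n := by
    rw [hs, ← Real.rpow_mul (by positivity), inv_mul_cancel₀ hκ.ne', Real.rpow_one]
  have hs2 : s ≤ 1 / 2 := by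
    rw [← Real.rpow_le_rpow_iff hs0.le (by norm_num) hκ, hsκ]
    exact (div_le_self hη0.le hn1).trans (min_le_right _ _)
  have hm : nbhdLength K s * (n + 1) ≤ 1 / 2 := by
    have h1 := (hreg s hs0 hs2).2
    rw [← hκdef, hsκ] at h1
    have h2 : b * (η / n) * (n + 1) ≤ 1 / 2 := by
      have h3 : b * η ≤ 1 / 4 := by
        calc b * η ≤ b * (1 / (4 * b)) := by gcongr; exact min_le_left _ _
          _ = 1 / 4 := by field_simp
      have h4 : b * (η / n) * (n + 1) = (b * η) * ((n + 1) / n) := by ring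
      have h5 : ((n : ℝ) + 1) / n ≤ 2 := by rw [div_le_iff₀ hn0]; linarith
      rw [h4]
      have : 0 ≤ ((n : ℝ) + 1) / n := by positivity
      nlinarith
    exact (mul_le_mul_of_nonneg_right h1 (by positivity)).trans h2
  have hX := (integral_truncWeight_bounds hγ1 hne hreg hs0 hs2).2
  rw [← hκdef] at hX
  have hY : s ^ (-κ) / 2 ^ κ = n * (η⁻¹ / 2 ^ κ) := by
    rw [Real.rpow_neg hs0.le, hsκ]; field_simp
  rw [hY, Real.log_mul hn0.ne' (by positivity)] at hX
  have habs := mul_le_mul_of_nonneg_left (le_abs_self (Real.log (η⁻¹ / 2 ^ κ))) hb.le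
  rw [szegoMin_deepZeroMeasure hK]
  refine le_ciInf fun q => Real.le_sqrt_of_sq_le ?_
  have hkey := exp_neg_le_two_mul_integral (γ := γ) hK hne hγ1 hs0 (monic_monicOfCoeffs q)
    (by rwa [natDegree_monicOfCoeffs])
  rw [← Real.exp_nat_mul]
  have h2 : Real.exp (-(∫ t, truncWeight (1 - γ) s K t ∂AddCircle.haarAddCircle) - Real.log 2) ≤
      ∫ t, deepZeroDensity γ K t * ‖(monicOfCoeffs q).eval (circlePoint t)‖ ^ 2
        ∂AddCircle.haarAddCircle := by
    rw [Real.exp_sub, Real.exp_log two_pos]; linarith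
  refine le_trans (Real.exp_le_exp.2 ?_) h2
  rw [← hκdef]; push_cast; linarith

/-! ### Reversed polynomials and the Fejér kernel -/

/-- The reversal `z ^ n Q(1/z)` has leading coefficient `Q(0) = 1`. Competitors may thus be built as
polynomials in `z⁻¹` with constant term 1. -/
theorem exists_norm_eval_monicOfCoeffs {n : ℕ} {Q : ℂ[X]} (hdeg : Q.natDegree ≤ n)
    (h0 : Q.coeff 0 = 1) :
    ∃ q : Fin n → ℂ, ∀ z : ℂ, ‖z‖ = 1 → ‖(monicOfCoeffs q).eval z‖ = ‖Q.eval z⁻¹‖ := by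
  refine ⟨fun j => Q.coeff (n - j), fun z hz => ?_⟩
  have hz0 : z ≠ 0 := norm_ne_zero_iff.1 (by rw [hz]; exact one_ne_zero)
  have h1 : z ^ n * Q.eval z⁻¹ = ∑ j ∈ Finset.range (n + 1), Q.coeff (n - j) * z ^ j := by
    rw [eval_eq_sum_range' (Nat.lt_succ_of_le hdeg), Finset.mul_sum, ← Finset.sum_range_reflect]
    refine Finset.sum_congr rfl fun j hj => ?_
    have hjn : j ≤ n := Nat.lt_succ_iff.1 (Finset.mem_range.1 hj)
    rw [Nat.succ_eq_add_one, Nat.add_sub_cancel, inv_pow, ← pow_mul_pow_sub z hjn]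
    have := pow_ne_zero (n - j) hz0
    field_simp
  have : (monicOfCoeffs fun j : Fin n => Q.coeff (n - j)).eval z = z ^ n * Q.eval z⁻¹ := by
    rw [eval_monicOfCoeffs, Fin.sum_univ_eq_sum_range fun j => Q.coeff (n - j) * z ^ j, h1,
      Finset.sum_range_succ, Nat.sub_self, h0, one_mul]
  rw [this, norm_mul, norm_pow, hz, one_pow, one_mul]

theorem integral_eval_circlePoint (P : ℂ[X]) :
    ∫ t, P.eval (circlePoint t) ∂AddCircle.haarAddCircle = P.coeff 0 := by
  simp_rw [eval_eq_sum_range]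
  have hc := continuous_circlePoint
  rw [integral_finsetSum _ fun i _ => integrable_of_continuous (by fun_prop),
    Finset.sum_range_succ']
  simp only [integral_const_mul, integral_circlePoint_pow_succ]
  simp

/-- The analytic polynomial whose real part on the unit circle is the Fejér kernel. -/
noncomputable def analyticFejer (N : ℕ) : ℂ[X] :=
  C (N : ℂ)⁻¹ * ∑ j ∈ Finset.range N, (1 + C 2 * (X * ∑ i ∈ Finset.range j, X ^ i))

theorem eval_analyticFejer (N : ℕ) (z : ℂ) : (analyticFejer N).eval z =
    (N : ℂ)⁻¹ * ∑ j ∈ Finset.range N, (1 + 2 * (z * ∑ i ∈ Finset.range j, z ^ i)) := by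
  simp [analyticFejer, eval_finsetSum]

theorem coeff_zero_analyticFejer {N : ℕ} (hN : N ≠ 0) : (analyticFejer N).coeff 0 = 1 := by
  rw [coeff_zero_eq_eval_zero, eval_analyticFejer]
  simp [hN]

theorem natDegree_analyticFejer_le (N : ℕ) : (analyticFejer N).natDegree ≤ N := by
  refine (natDegree_C_mul_le _ _).trans (natDegree_sum_le_of_forall_le _ _ fun j hj => ?_)
  refine (natDegree_add_le _ _).trans (max_le (by simp) ((natDegree_C_mul_le _ _).trans ?_))
  rw [Finset.mul_sum]
  refine natDegree_sum_le_of_forall_le _ _ fun i hi => ?_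
  rw [← pow_succ', natDegree_X_pow]
  simp only [Finset.mem_range] at hi hj
  omega

theorem re_eval_analyticFejer (N : ℕ) {z : ℂ} (hz : ‖z‖ = 1) :
    ((analyticFejer N).eval z).re = (N : ℝ)⁻¹ * ‖∑ k ∈ Finset.range N, z ^ k‖ ^ 2 := by
  have key : ∀ M : ℕ, (∑ j ∈ Finset.range M, (1 + 2 * (z * ∑ i ∈ Finset.range j, z ^ i))).re =
      ‖∑ k ∈ Finset.range M, z ^ k‖ ^ 2 := by
    intro M
    induction M with
    | zero => simp
    | succ M ih =>
      -- The increment matches because `‖1 + z D‖² = ‖D‖² + 1 + 2 Re (z D)` when `‖z‖ = 1`.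
      rw [Finset.sum_range_succ, Complex.add_re, ih, Finset.sum_range_succ' (fun k => z ^ k)]
      simp_rw [fun k => pow_succ' z k]
      rw [← Finset.mul_sum, pow_zero]
      set D := ∑ k ∈ Finset.range M, z ^ k
      have h1 : ‖D‖ ^ 2 = ‖z * D‖ ^ 2 := by rw [norm_mul, hz, one_mul]
      rw [h1, ← Complex.normSq_eq_norm_sq, ← Complex.normSq_eq_norm_sq, Complex.normSq_apply,
        Complex.normSq_apply]
      simp
      ring
  rw [eval_analyticFejer, ← key, ← Complex.ofReal_natCast, ← Complex.ofReal_inv, Complex.re_ofReal_mul]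

theorem re_eval_analyticFejer_nonneg (N : ℕ) {z : ℂ} (hz : ‖z‖ = 1) :
    0 ≤ ((analyticFejer N).eval z).re := by
  rw [re_eval_analyticFejer N hz]; positivity

theorem re_eval_analyticFejer_mul_le (N : ℕ) {z : ℂ} (hz : ‖z‖ = 1) :
    ((analyticFejer N).eval z).re * ‖z - 1‖ ^ 2 ≤ 4 / N := by
  rw [re_eval_analyticFejer N hz, mul_assoc, ← mul_pow, ← norm_mul, geom_sum_mul, inv_mul_eq_div]
  gcongr
  have : ‖z ^ N - 1‖ ≤ 2 := (norm_sub_le _ _).trans (by rw [norm_pow, hz]; norm_num)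
  nlinarith [norm_nonneg (z ^ N - 1)]

theorem norm_eval_analyticFejer_sub_one_le {N : ℕ} (hN : N ≠ 0) {z : ℂ} (hz : ‖z‖ = 1) :
    ‖(analyticFejer N).eval z - 1‖ ≤ 2 * N := by
  have hN' : (N : ℂ) ≠ 0 := Nat.cast_ne_zero.2 hN
  have h : (analyticFejer N).eval z - 1 =
      (N : ℂ)⁻¹ * ∑ j ∈ Finset.range N, 2 * (z * ∑ i ∈ Finset.range j, z ^ i) := by
    rw [eval_analyticFejer, Finset.sum_add_distrib, mul_add]
    simp [hN']
  have hj : ∀ j ∈ Finset.range N, ‖2 * (z * ∑ i ∈ Finset.range j, z ^ i)‖ ≤ 2 * N := by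
    intro j hj
    rw [norm_mul, norm_mul, hz, one_mul]
    have : ‖∑ i ∈ Finset.range j, z ^ i‖ ≤ ∑ i ∈ Finset.range j, (1 : ℝ) :=
      (norm_sum_le _ _).trans (Finset.sum_le_sum fun i _ => by rw [norm_pow, hz, one_pow])
    have hjN : (j : ℝ) ≤ N := by exact_mod_cast (Finset.mem_range.1 hj).le
    simp at this ⊢
    linarith
  rw [h, norm_mul, norm_inv, Complex.norm_natCast]
  have := (norm_sum_le _ _).trans (Finset.sum_le_sum hj)
  rw [Finset.sum_const, Finset.card_range, nsmul_eq_mul] at this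
  rw [inv_mul_le_iff₀ (by positivity)]
  exact this

/-! ### Fejér means -/

/-- The convolution of `v` with the analytic Fejér kernel, as a polynomial in `t⁻¹`. -/
noncomputable def fejerPoly (N : ℕ) (v : SzegoCircle → ℝ) : ℂ[X] :=
  ∑ k ∈ Finset.range (N + 1), C ((analyticFejer N).coeff k *
    ∫ τ, (v τ : ℂ) * circlePoint τ ^ k ∂AddCircle.haarAddCircle) * X ^ k

theorem natDegree_fejerPoly_le (N : ℕ) (v : SzegoCircle → ℝ) : (fejerPoly N v).natDegree ≤ N :=
  natDegree_sum_le_of_forall_le _ _ fun _ hk =>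
    (natDegree_C_mul_X_pow_le _ _).trans (Nat.lt_succ_iff.1 (Finset.mem_range.1 hk))

theorem eval_zero_fejerPoly {N : ℕ} (hN : N ≠ 0) (v : SzegoCircle → ℝ) :
    (fejerPoly N v).eval 0 = ((∫ τ, v τ ∂AddCircle.haarAddCircle : ℝ) : ℂ) := by
  rw [fejerPoly, eval_finsetSum, Finset.sum_range_succ']
  simp [coeff_zero_analyticFejer hN]
  exact integral_ofReal

theorem circlePoint_sub (τ t : SzegoCircle) :
    circlePoint (τ - t) = circlePoint τ * (circlePoint t)⁻¹ := by
  simp [circlePoint, sub_eq_add_neg, AddCircle.toCircle_add, AddCircle.toCircle_neg]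

theorem eval_fejerPoly {N : ℕ} {v : SzegoCircle → ℝ} (hv : Continuous v) (t : SzegoCircle) :
    (fejerPoly N v).eval (circlePoint t)⁻¹ =
      ∫ τ, (v τ : ℂ) * (analyticFejer N).eval (circlePoint (τ - t)) ∂AddCircle.haarAddCircle := by
  simp_rw [eval_eq_sum_range' (Nat.lt_succ_of_le (natDegree_analyticFejer_le N)), Finset.mul_sum]
  rw [integral_finsetSum, fejerPoly, eval_finsetSum]
  · refine Finset.sum_congr rfl fun k _ => ?_
    simp only [eval_mul, eval_C, eval_pow, eval_X]
    rw [mul_assoc, ← integral_mul_const, ← integral_const_mul]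
    refine integral_congr_ae (Filter.Eventually.of_forall fun τ => ?_)
    simp only [circlePoint_sub, mul_pow]
    ring
  · intro k _
    exact integrable_of_continuous ((Complex.continuous_ofReal.comp hv).mul
      (continuous_const.mul ((continuous_circlePoint.comp (continuous_id.sub continuous_const)).pow k)))

theorem continuous_eval_circlePoint_sub (P : ℂ[X]) (t : SzegoCircle) :
    Continuous fun τ => P.eval (circlePoint (τ - t)) :=
  P.continuous.comp (continuous_circlePoint.comp (continuous_id.sub continuous_const))

theorem norm_eval_fejerPoly_sub_le {N : ℕ} (hN : N ≠ 0) {v : SzegoCircle → ℝ} (hv : Continuous v)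
    {V : ℝ} (hV : ∀ t, |v t| ≤ V) (t : SzegoCircle) :
    ‖(fejerPoly N v).eval (circlePoint t)⁻¹ - ((∫ τ, v τ ∂AddCircle.haarAddCircle : ℝ) : ℂ)‖ ≤
      V * (2 * N) := by
  have hvC : Continuous fun τ => (v τ : ℂ) := Complex.continuous_ofReal.comp hv
  have hA := continuous_eval_circlePoint_sub (analyticFejer N) t
  have hx : ((∫ τ, v τ ∂AddCircle.haarAddCircle : ℝ) : ℂ) =
      ∫ τ, (v τ : ℂ) ∂AddCircle.haarAddCircle := integral_ofReal.symm
  rw [eval_fejerPoly hv, hx, ← integral_sub (integrable_of_continuous (by fun_prop))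
    (integrable_of_continuous hvC)]
  refine (norm_integral_le_of_norm_le_const (C := V * (2 * N))
    (Filter.Eventually.of_forall fun τ => ?_)).trans (by simp)
  rw [← mul_sub_one, norm_mul, Complex.norm_real]
  exact mul_le_mul (hV τ) (norm_eval_analyticFejer_sub_one_le hN (norm_circlePoint _))
    (norm_nonneg _) ((abs_nonneg _).trans (hV τ))

/-- The real part of the kernel is nonnegative with integral 1. With `r` the chord from `τ` to `t`,
`L ‖τ - t‖ ≤ L r / 4 ≤ 1/2 + L² r² / 32`, and the kernel times `r²` is at most `4 / N`. -/
theorem re_eval_fejerPoly_le {N : ℕ} (hN : N ≠ 0) {v : SzegoCircle → ℝ} (hv : Continuous v)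
    {L : ℝ} (hL0 : 0 ≤ L) (hL : ∀ τ t, v τ ≤ v t + L * ‖τ - t‖) (t : SzegoCircle) :
    ((fejerPoly N v).eval (circlePoint t)⁻¹).re ≤ v t + 1 / 2 + L ^ 2 / (8 * N) := by
  set R : SzegoCircle → ℝ := fun τ => ((analyticFejer N).eval (circlePoint (τ - t))).re with hR
  have hRc : Continuous R := Complex.continuous_re.comp (continuous_eval_circlePoint_sub _ t)
  have h1 : ((fejerPoly N v).eval (circlePoint t)⁻¹).re =
      ∫ τ, v τ * R τ ∂AddCircle.haarAddCircle := by
    rw [eval_fejerPoly hv]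
    have := integral_re (𝕜 := ℂ) (integrable_of_continuous
      ((Complex.continuous_ofReal.comp hv).mul
        (continuous_eval_circlePoint_sub (analyticFejer N) t)))
    refine this.symm.trans (integral_congr_ae (Filter.Eventually.of_forall fun τ => ?_))
    simp [hR]
  have h2 : ∫ τ, R τ ∂AddCircle.haarAddCircle = 1 := by
    rw [integral_sub_right_eq_self (μ := AddCircle.haarAddCircle)
      (fun τ => ((analyticFejer N).eval (circlePoint τ)).re) t]
    have := integral_re (𝕜 := ℂ) (integrable_of_continuous
      ((analyticFejer N).continuous.comp continuous_circlePoint))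
    refine this.trans ?_
    simp only [Function.comp_def]
    rw [integral_eval_circlePoint, coeff_zero_analyticFejer hN]
    simp
  have hpt : ∀ τ, v τ * R τ ≤ (v t + 1 / 2) * R τ + L ^ 2 / (8 * N) := fun τ => by
    have hz := norm_circlePoint (τ - t)
    have hR0 : 0 ≤ R τ := re_eval_analyticFejer_nonneg N hz
    have hR1 : R τ * ‖circlePoint (τ - t) - 1‖ ^ 2 ≤ 4 / N := re_eval_analyticFejer_mul_le N hz
    have hd := norm_le_norm_circlePoint_sub_one (τ - t)
    set r := ‖circlePoint (τ - t) - 1‖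
    have hLr : L * ‖τ - t‖ ≤ 1 / 2 + L ^ 2 * r ^ 2 / 32 := by
      have := mul_le_mul_of_nonneg_left hd hL0
      nlinarith [sq_nonneg (L * r / 4 - 1)]
    have h3 : v τ * R τ ≤ (v t + 1 / 2 + L ^ 2 * r ^ 2 / 32) * R τ :=
      mul_le_mul_of_nonneg_right ((hL τ t).trans (by linarith)) hR0
    have h4 : L ^ 2 / 32 * (R τ * r ^ 2) ≤ L ^ 2 / 32 * (4 / N) := by gcongr
    have h5 : L ^ 2 / 32 * (4 / N) = L ^ 2 / (8 * N) := by field_simp; ring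
    linarith
  rw [h1]
  refine (integral_mono (integrable_of_continuous (by fun_prop)) (integrable_of_continuous
    (by fun_prop)) hpt).trans_eq ?_
  rw [integral_add (integrable_of_continuous (by fun_prop)) (integrable_const _),
    integral_const_mul, h2]
  simp

/-! ### Truncated exponentials and the test polynomial -/

/-- From `(e B) ^ J / J! ≤ exp (e B)` follows `B ^ J / J! ≤ exp (e B - J) ≤ exp (-B)`, since `e < 3`
and `J ≥ 4 B`. -/
theorem norm_exp_sub_sum_le {g : ℂ} {B : ℝ} {J : ℕ} (hg : ‖g‖ ≤ B) (hJ : 4 * B ≤ J) :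
    ‖Complex.exp g - ∑ j ∈ Finset.range J, g ^ j / (j.factorial : ℂ)‖ ≤ 2 * Real.exp (-B) := by
  have hB : 0 ≤ B := (norm_nonneg g).trans hg
  refine (Complex.exp_bound' ?_).trans ?_
  · rw [div_le_iff₀ (by positivity)]; push_cast; linarith
  · have h1 : ‖g‖ ^ J / J.factorial ≤ Real.exp (-B) := by
      have h2 := Real.pow_div_factorial_le_exp (x := Real.exp 1 * B) (by positivity) J
      have h3 : (Real.exp 1 * B) ^ J / J.factorial = Real.exp J * (B ^ J / J.factorial) := by
        rw [mul_pow, ← Real.exp_nat_mul, mul_one, mul_div_assoc]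
      rw [h3, ← le_div_iff₀' (Real.exp_pos _), ← Real.exp_sub] at h2
      calc ‖g‖ ^ J / J.factorial ≤ B ^ J / J.factorial := by gcongr
        _ ≤ _ := h2.trans (Real.exp_le_exp.2 (by nlinarith [Real.exp_one_lt_d9]))
    linarith

theorem rpow_neg_sub_le {κ s x y : ℝ} (hκ0 : 0 < κ) (hκ1 : κ ≤ 1) (hs : 0 < s) (hx : s ≤ x)
    (hy : s ≤ y) : x ^ (-κ) - y ^ (-κ) ≤ s ^ (-κ - 1) * |x - y| := by
  have hx0 := hs.trans_le hx
  have hy0 := hs.trans_le hy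
  rcases le_total y x with h | h
  · have := Real.rpow_le_rpow_of_nonpos hy0 h (neg_nonpos.2 hκ0.le)
    exact (sub_nonpos.2 this).trans (by positivity)
  · have h1 : y ^ (-κ) = x ^ (-κ) * (x / y) ^ κ := by
      rw [Real.div_rpow hx0.le hy0.le, Real.rpow_neg hx0.le, Real.rpow_neg hy0.le]
      have := (Real.rpow_pos_of_pos hx0 κ).ne'
      field_simp
    have h2 : x / y ≤ (x / y) ^ κ := by
      have := Real.rpow_le_rpow_of_exponent_ge (by positivity) ((div_le_one hy0).2 h) hκ1
      rwa [Real.rpow_one] at this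
    have h3 : x ^ (-κ) ≤ s ^ (-κ) := Real.rpow_le_rpow_of_nonpos hs hx (neg_nonpos.2 hκ0.le)
    have h4 : 1 - (x / y) ^ κ ≤ |x - y| / s := by
      rw [abs_of_nonpos (sub_nonpos.2 h), neg_sub]
      calc 1 - (x / y) ^ κ ≤ 1 - x / y := by linarith
        _ = (y - x) / y := by field_simp
        _ ≤ (y - x) / s := div_le_div_of_nonneg_left (sub_nonneg.2 h) hs hy
    have h5 : s ^ (-κ - 1) * |x - y| = s ^ (-κ) * (|x - y| / s) := by
      rw [Real.rpow_sub_one hs.ne']; ring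
    rw [h1, h5, ← mul_one_sub]
    calc x ^ (-κ) * (1 - (x / y) ^ κ) ≤ x ^ (-κ) * (|x - y| / s) := by gcongr
      _ ≤ _ := by gcongr

theorem truncWeight_le_add {κ s : ℝ} (hκ0 : 0 < κ) (hκ1 : κ ≤ 1) (hs : 0 < s)
    (K : Set SzegoCircle) (τ t : SzegoCircle) :
    truncWeight κ s K τ ≤ truncWeight κ s K t + s ^ (-κ - 1) * ‖τ - t‖ := by
  have h1 := rpow_neg_sub_le hκ0 hκ1 hs (le_max_right (Metric.infDist τ K) s)
    (le_max_right (Metric.infDist t K) s)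
  have h2 : |max (Metric.infDist τ K) s - max (Metric.infDist t K) s| ≤ ‖τ - t‖ := by
    refine (abs_max_sub_max_le_abs _ _ _).trans ?_
    rw [← dist_eq_norm, ← Real.dist_eq]
    simpa using (Metric.lipschitz_infDist_pt K).dist_le_mul τ t
  have := mul_le_mul_of_nonneg_left h2 (Real.rpow_nonneg hs.le (-κ - 1))
  unfold truncWeight
  linarith

theorem szegoMin_le_of_polynomial {γ : ℝ} {K : Set SzegoCircle} (hK : IsCompact K) {n : ℕ}
    {Q : ℂ[X]} (hdeg : Q.natDegree ≤ n) (h0 : Q.coeff 0 = 1) {M : ℝ} (hM : 0 ≤ M)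
    (hQ : ∀ t, deepZeroDensity γ K t * ‖Q.eval (circlePoint t)⁻¹‖ ^ 2 ≤ M ^ 2) :
    szegoMin (deepZeroMeasure γ K) n ≤ M := by
  obtain ⟨q, hq⟩ := exists_norm_eval_monicOfCoeffs hdeg h0
  rw [szegoMin_deepZeroMeasure hK]
  refine (ciInf_le (bddBelow_range_sqrt _) q).trans (Real.sqrt_le_iff.2 ⟨hM, ?_⟩)
  simp_rw [hq _ (norm_circlePoint _)]
  refine (integral_mono_of_nonneg (Filter.Eventually.of_forall fun t =>
    mul_nonneg (deepZeroDensity_nonneg t) (sq_nonneg _)) (integrable_const (M ^ 2))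
    (Filter.Eventually.of_forall hQ)).trans_eq (by simp)

/-- The competitor `t ^ n` suffices: `d_K ≤ 1/2` keeps the density below `exp (-1)`. This handles
small `n`, where the logarithmic bound is void. -/
theorem szegoMin_le_exp_neg_half {γ : ℝ} (hγ1 : γ < 1) {K : Set SzegoCircle}
    (hK : IsCompact K) (hne : K.Nonempty) (n : ℕ) :
    szegoMin (deepZeroMeasure γ K) n ≤ Real.exp (-(1 / 2)) := by
  refine szegoMin_le_of_polynomial hK (Q := 1) (by simp) (by simp) (Real.exp_pos _).le fun t => ?_
  have h1 := deepZeroDensity_le_exp_neg_truncWeight (s := 1 / 2) hK hne hγ1 t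
  obtain ⟨k, hk⟩ := hne
  have hd : Metric.infDist t K ≤ 1 / 2 := (Metric.infDist_le_dist_of_mem hk).trans <| by
    rw [dist_eq_norm]; simpa using AddCircle.norm_le_half_period (1 : ℝ) one_ne_zero (x := t - k)
  have h2 : 1 ≤ truncWeight (1 - γ) (1 / 2) K t := by
    rw [truncWeight, max_eq_right hd]
    exact Real.one_le_rpow_of_pos_of_le_one_of_nonpos (by norm_num) (by norm_num) (by linarith)
  rw [← Real.exp_nat_mul]
  simp only [eval_one, norm_one, one_pow, mul_one]
  refine h1.trans (Real.exp_le_exp.2 ?_)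
  norm_num
  exact h2

/-- The truncated exponential of the polynomial `H`. -/
noncomputable def expTrunc (J : ℕ) (H : ℂ[X]) : ℂ[X] :=
  ∑ j ∈ Finset.range J, C ((j.factorial : ℂ)⁻¹) * H ^ j

theorem eval_expTrunc (J : ℕ) (H : ℂ[X]) (z : ℂ) :
    (expTrunc J H).eval z = ∑ j ∈ Finset.range J, H.eval z ^ j / (j.factorial : ℂ) := by
  simp [expTrunc, eval_finsetSum, div_eq_inv_mul]

theorem natDegree_expTrunc_le {J N : ℕ} {H : ℂ[X]} (hH : H.natDegree ≤ N) :
    (expTrunc J H).natDegree ≤ J * N := by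
  refine natDegree_sum_le_of_forall_le _ _ fun j hj => (natDegree_C_mul_le _ _).trans ?_
  exact natDegree_pow_le.trans (Nat.mul_le_mul (Finset.mem_range.1 hj).le hH)

theorem coeff_zero_expTrunc {J : ℕ} (hJ : J ≠ 0) {H : ℂ[X]} (hH : H.eval 0 = 0) :
    (expTrunc J H).coeff 0 = 1 := by
  obtain ⟨J, rfl⟩ := Nat.exists_eq_succ_of_ne_zero hJ
  rw [coeff_zero_eq_eval_zero, eval_expTrunc, hH, Finset.sum_range_succ']
  simp

theorem szegoMin_le_exp_neg_integral_truncWeight {γ : ℝ} (hγ0 : 0 ≤ γ) (hγ1 : γ < 1)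
    {K : Set SzegoCircle} (hK : IsCompact K) (hne : K.Nonempty) {m n : ℕ} (hm : 2 ≤ m)
    (hn : 4 * m ^ 9 ≤ n) :
    szegoMin (deepZeroMeasure γ K) n ≤ 5 * Real.exp
      (-(∫ t, truncWeight (1 - γ) (m : ℝ)⁻¹ K t ∂AddCircle.haarAddCircle) / 2) := by
  set κ := 1 - γ with hκ
  have hκ0 : 0 < κ := by linarith
  have hκ1 : κ ≤ 1 := by linarith
  have hm1 : (1 : ℝ) ≤ m := by exact_mod_cast (by omega : 1 ≤ m)
  have hm0 : (0 : ℝ) < m := by linarith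
  set s : ℝ := (m : ℝ)⁻¹ with hs
  have hs0 : 0 < s := by positivity
  have hs1 : s ^ (-κ) ≤ m := by
    rw [hs, Real.inv_rpow hm0.le, Real.rpow_neg hm0.le, inv_inv]
    exact (Real.rpow_le_rpow_of_exponent_le hm1 hκ1).trans_eq (Real.rpow_one _)
  have hs2 : s ^ (-κ - 1) ≤ (m : ℝ) ^ 2 := by
    rw [Real.rpow_sub_one hs0.ne', hs, div_inv_eq_mul, sq]
    gcongr
  set v : SzegoCircle → ℝ := fun t => truncWeight κ s K t / 2 with hv
  have hvc : Continuous v := (continuous_truncWeight hs0).div_const 2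
  have hv0 : ∀ t, 0 ≤ v t := fun t => div_nonneg (truncWeight_nonneg hs0 t) two_pos.le
  have hvm : ∀ t, v t ≤ m / 2 := fun t => by
    have := (truncWeight_le (K := K) hκ0.le hs0 t).trans hs1
    simp only [hv]; linarith
  set x := ∫ t, v t ∂AddCircle.haarAddCircle with hx
  have hxX : -(∫ t, truncWeight κ s K t ∂AddCircle.haarAddCircle) / 2 = -x := by
    rw [hx, integral_div]; ring
  have hxm : x ≤ m / 2 := by
    have := integral_mono (integrable_of_continuous hvc) (integrable_const _) hvm
    simpa using this
  -- The Lipschitz constant of `v` is at most `m² / 2`, so this `N` makes the Fejér error term `L² /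
  -- (8 N)` equal to `1/32`. The crude bound `(m / 2) (2 N) = m ^ 5` on `H` then dictates `J = 4 m ^
  -- 5`.
  set N := m ^ 4 with hN
  have hN0 : N ≠ 0 := by positivity
  set B : ℝ := (m : ℝ) ^ 5 with hB
  have hmB : (m : ℝ) ≤ B := by simpa using pow_le_pow_right₀ hm1 (show 1 ≤ 5 by norm_num)
  set H := fejerPoly N v - C (x : ℂ) with hH
  have hHdeg : H.natDegree ≤ N := by
    rw [hH, natDegree_sub_C]; exact natDegree_fejerPoly_le N v
  have hH0 : H.eval 0 = 0 := by
    rw [hH, eval_sub, eval_zero_fejerPoly hN0, eval_C, sub_self]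
  have hHnorm : ∀ t, ‖H.eval (circlePoint t)⁻¹‖ ≤ B := fun t => by
    rw [hH, eval_sub, eval_C]
    refine (norm_eval_fejerPoly_sub_le hN0 hvc
      (fun t => (abs_of_nonneg (hv0 t)).trans_le (hvm t)) t).trans_eq ?_
    rw [hN, hB]; push_cast; ring
  have hHre : ∀ t, (H.eval (circlePoint t)⁻¹).re ≤ v t + 1 - x := fun t => by
    have h1 := re_eval_fejerPoly_le hN0 hvc (L := (m : ℝ) ^ 2 / 2) (by positivity) (fun τ t => by
      have h2 := truncWeight_le_add hκ0 hκ1 hs0 K τ t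
      have h3 := mul_le_mul_of_nonneg_right hs2 (norm_nonneg (τ - t))
      simp only [hv]; linarith) t
    have h2 : ((m : ℝ) ^ 2 / 2) ^ 2 / (8 * (N : ℕ)) = 1 / 32 := by
      rw [hN]; push_cast; field_simp; norm_num
    rw [h2] at h1
    rw [hH, eval_sub, eval_C, Complex.sub_re, Complex.ofReal_re]
    linarith
  rw [hxX]
  refine szegoMin_le_of_polynomial hK (Q := expTrunc (4 * m ^ 5) H)
    ((natDegree_expTrunc_le hHdeg).trans (by rw [hN]; linarith [show 4 * m ^ 5 * m ^ 4 = 4 * m ^ 9 by ring]))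
    (coeff_zero_expTrunc (by positivity) hH0) (by positivity) fun t => ?_
  have hQ : ‖(expTrunc (4 * m ^ 5) H).eval (circlePoint t)⁻¹‖ ≤ 5 * Real.exp (v t - x) := by
    have h1 := norm_exp_sub_sum_le (J := 4 * m ^ 5) (hHnorm t) (by push_cast; exact le_rfl)
    rw [← eval_expTrunc] at h1
    have h2 : ‖Complex.exp (H.eval (circlePoint t)⁻¹)‖ ≤ Real.exp 1 * Real.exp (v t - x) := by
      rw [Complex.norm_exp, ← Real.exp_add]
      exact Real.exp_le_exp.2 (by linarith [hHre t])
    -- The truncation error is absorbed because `v t - x ≥ -m / 2 ≥ -B`; the constant 5 bounds `e +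
    -- 2`.
    have h3 : Real.exp (-B) ≤ Real.exp (v t - x) :=
      Real.exp_le_exp.2 (by linarith [hv0 t])
    have h4 := norm_le_norm_add_norm_sub (Complex.exp (H.eval (circlePoint t)⁻¹))
      ((expTrunc (4 * m ^ 5) H).eval (circlePoint t)⁻¹)
    have h5 := mul_le_mul_of_nonneg_right Real.exp_one_lt_d9.le (Real.exp_pos (v t - x)).le
    linarith [Real.exp_pos (v t - x)]
  have hW := deepZeroDensity_le_exp_neg_truncWeight (s := s) hK hne hγ1 t
  calc deepZeroDensity γ K t * ‖(expTrunc (4 * m ^ 5) H).eval (circlePoint t)⁻¹‖ ^ 2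
      ≤ Real.exp (-truncWeight κ s K t) * (5 * Real.exp (v t - x)) ^ 2 := by gcongr
    _ = (5 * Real.exp (-x)) ^ 2 := by
      rw [mul_pow, mul_pow, ← Real.exp_nat_mul, ← Real.exp_nat_mul, mul_left_comm, ← Real.exp_add]
      congr 2
      simp only [hv]; push_cast; ring

theorem exists_pow_le_lt_succ_pow {k : ℕ} (hk : k ≠ 0) (n : ℕ) :
    ∃ m : ℕ, m ^ k ≤ n ∧ n < (m + 1) ^ k := by
  induction n with
  | zero => exact ⟨0, by simp [hk], by simp⟩
  | succ n ih =>
    obtain ⟨m, h1, h2⟩ := ih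
    rcases (Nat.succ_le_of_lt h2).lt_or_eq with h | h
    · exact ⟨m, h1.trans n.le_succ, h⟩
    · exact ⟨m + 1, h.ge, h.trans_lt (Nat.pow_lt_pow_left (by omega) hk)⟩

/-- The upper bound for `e_n`. -/
theorem szegoMin_upper_bound {γ a b : ℝ} (hγ0 : 0 ≤ γ) (hγ1 : γ < 1) (ha : 0 < a) :
    ∃ A B : ℝ, 0 < A ∧ 0 ≤ B ∧ ∀ K : Set SzegoCircle, IsCompact K → IsGammaRegularWith γ a b K →
      ∀ n : ℕ, 2 ≤ n →
        szegoMin (deepZeroMeasure γ K) n ≤ Real.exp (-(A * Real.log n - B)) := by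
  have hκ : 0 < 1 - γ := by linarith
  have hl2 : 0 < Real.log 2 := Real.log_pos one_lt_two
  have hl5 : 0 < Real.log 5 := Real.log_pos (by norm_num)
  refine ⟨a * (1 - γ) / 2 / 10, a * (1 - γ) / 2 * (2 * Real.log 2) + Real.log 5, by positivity,
    by positivity, fun K hK hreg n hn => ?_⟩
  have hne := hreg.nonempty ha
  set α := a * (1 - γ) / 2 with hα
  have hα0 : 0 < α := by positivity
  obtain ⟨m, hmn, hnm⟩ := exists_pow_le_lt_succ_pow (k := 10) (by norm_num) n
  have hn0 : (0 : ℝ) < n := by positivity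
  have hm1 : 1 ≤ m := by
    by_contra h
    obtain rfl : m = 0 := by omega
    norm_num at hnm
    omega
  have hm0 : (0 : ℝ) < m := by exact_mod_cast hm1
  have hlog : Real.log n ≤ 10 * (Real.log m + Real.log 2) := by
    have h1 : (n : ℝ) ≤ (m * 2) ^ 10 := by
      exact_mod_cast hnm.le.trans (Nat.pow_le_pow_left (by omega) 10)
    have h2 := Real.log_le_log hn0 h1
    rwa [Real.log_pow, Real.log_mul hm0.ne' two_ne_zero] at h2
  -- For `m ≥ 4`, `4 m ^ 9 ≤ m ^ 10 ≤ n`. For `m < 4`, `n ≤ 2 ^ 20` and the term `2 log 2` in the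
  -- constant absorbs `log n / 10`.
  rcases lt_or_ge m 4 with hm4 | hm4
  · refine (szegoMin_le_exp_neg_half hγ1 hK hne n).trans (Real.exp_le_exp.2 ?_)
    have h1 : Real.log n ≤ 20 * Real.log 2 := by
      have h2 : (n : ℝ) ≤ 2 ^ 20 := by
        exact_mod_cast hnm.le.trans (Nat.pow_le_pow_left (by omega : m + 1 ≤ 4) 10)
      have h3 := Real.log_le_log hn0 h2
      rwa [Real.log_pow] at h3
    have h4 := mul_le_mul_of_nonneg_left h1 hα0.le
    linarith
  · have hX := (integral_truncWeight_bounds hγ1 hne hreg (s := (m : ℝ)⁻¹) (by positivity) (by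
      rw [one_div]
      exact inv_anti₀ two_pos (by exact_mod_cast (by omega : 2 ≤ m)))).1
    have hY : ((m : ℝ)⁻¹) ^ (-(1 - γ)) / 2 ^ (1 - γ) = (m / 2 : ℝ) ^ (1 - γ) := by
      rw [Real.inv_rpow hm0.le, Real.rpow_neg hm0.le, inv_inv, Real.div_rpow hm0.le two_pos.le]
    rw [hY, Real.log_rpow (by positivity), Real.log_div hm0.ne' two_ne_zero] at hX
    have hdeg : 4 * m ^ 9 ≤ n := le_trans (by rw [pow_succ' m 9]; gcongr) hmn
    refine (szegoMin_le_exp_neg_integral_truncWeight hγ0 hγ1 hK hne (by omega) hdeg).trans ?_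
    nth_rw 1 [← Real.exp_log (show (0 : ℝ) < 5 by norm_num)]
    rw [← Real.exp_add]
    refine Real.exp_le_exp.2 ?_
    have := mul_le_mul_of_nonneg_left hlog hα0.le
    have : a * ((1 - γ) * (Real.log m - Real.log 2)) = 2 * α * (Real.log m - Real.log 2) := by
      rw [hα]; ring
    linarith

/-! ### Conclusion -/

theorem mainTheorem7 (γ : ℝ) (hγ0 : 0 ≤ γ) (hγ1 : γ < 1)
    (a b : ℝ) (ha : 0 < a) (hb : 0 < b) :
    ∃ c C : ℝ, 0 < c ∧ 0 < C ∧
      ∀ K : Set SzegoCircle, IsCompact K → IsGammaRegularWith γ a b K →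
        ∀ n : ℕ, 2 ≤ n →
          c * Real.log n ≤ |Real.log (szegoMin (deepZeroMeasure γ K) n)| ∧
          |Real.log (szegoMin (deepZeroMeasure γ K) n)| ≤ C * Real.log n := by
  obtain ⟨A, B, hA, hB, hup⟩ := szegoMin_upper_bound (b := b) hγ0 hγ1 ha
  obtain ⟨A', B', hA', hB', hlow⟩ := szegoMin_lower_bound hγ1 ha hb
  have hl2 : 0 < Real.log 2 := Real.log_pos one_lt_two
  refine ⟨A / (1 + 2 * B), A' + B' / Real.log 2 + 1, by positivity, by positivity,
    fun K hK hreg n hn => ?_⟩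
  have hl : Real.log 2 ≤ Real.log n := Real.log_le_log two_pos (by exact_mod_cast hn)
  have h1 := hlow K hK hreg n hn
  have hpos := (Real.exp_pos _).trans_le h1
  have h2 := Real.log_le_log hpos (hup K hK hreg n hn)
  have h3 := Real.log_le_log hpos (szegoMin_le_exp_neg_half hγ1 hK (hreg.nonempty ha) n)
  have h4 := Real.log_le_log (Real.exp_pos _) h1
  rw [Real.log_exp] at h2 h3 h4
  rw [abs_of_neg (by linarith)]
  constructor
  -- With `y = |log e_n| ≥ 1/2`, the additive constant is absorbed: `A log n ≤ y + B ≤ (1 + 2 B) y`.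
  · rw [div_mul_eq_mul_div, div_le_iff₀ (by positivity)]
    nlinarith
  · have h5 : B' ≤ B' / Real.log 2 * Real.log n := by
      rw [div_mul_eq_mul_div, le_div_iff₀ hl2]
      exact mul_le_mul_of_nonneg_left hl hB'
    linarith
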